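/- Let $\gamma \in (-1,0]$, let $p \ge 1$ be real, let $f:\mathbb{R}\to[0,+\infty)$ be Lipschitz continuous, and let $V(y)=\frac{|y|^p}{p}$ for $y\in\mathbb{R}$. For $t\ge 0$ and $z\in\mathbb{R}$ define, if $\gamma\neq 0$, $$h_t^{(\gamma)}(z)=\sup\left\{\left(f(x)^{\gamma}+tV(y)\right)^{\frac1\gamma} : x,y\in\mathbb{R},\ z=x+ty,\ f(x)>0,\ V(y)>0\right\},$$ and, if $\gamma=0$, $$h_t^{(0)}(z)=\sup\left\{f(x)\,\mathrm{e}^{-tV(y)} : x,y\in\mathbb{R},\ z=x+ty\right\},$$ where the supremum of the empty set is $0$. Then the function $t\mapsto\int_{\mathbb{R}}h_t^{(\gamma)}(z)\,\mathrm{d}z$, which takes values in $[0,+\infty]$, is concave on $\mathbb{R}_+=[0,+\infty)$; that is, for all $s,t\ge 0$ and $\lambda\in[0,1]$, $$\int_{\mathbb{R}}h_{(1-\lambda)s+\lambda t}^{(\gamma)}(z)\,\mathrm{d}z\ \ge\ (1-\lambda)\int_{\mathbb{R}}h_s^{(\gamma)}(z)\,\mathrm{d}z+\lambda\int_{\mathbb{R}}h_t^{(\gamma)}(z)\,\mathrm{d}z,$$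 with the convention $0\cdot(+\infty)=0$. -/

import Mathlib

open scoped NNReal ENNReal

/-- The potential `V(y) = |y|^p / p` on the real line. -/
noncomputable def powerPotential (p : ℝ) (y : ℝ) : ℝ := |y| ^ p / p

/-- The function `h_t^{(γ)}` built from `f` and `V`, with values in `[0, ∞]`
(the supremum of the empty set is `0`):
for `γ ≠ 0` it is the supremum of `(f(x)^γ + t V(y))^{1/γ}` over all `x, y` with
`z = x + t y`, `f(x) > 0` and `V(y) > 0`;
for `γ = 0` it is the supremum of `f(x) exp(-t V(y))` over all `x, y` with `z = x + t y`. -/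
noncomputable def hopfLaxSup (γ : ℝ) (V f : ℝ → ℝ) (t : ℝ≥0) (z : ℝ) : ℝ≥0∞ :=
  if γ = 0 then
    ⨆ (x : ℝ) (y : ℝ) (_ : z = x + t * y), ENNReal.ofReal (f x * Real.exp (-(t * V y)))
  else
    ⨆ (x : ℝ) (y : ℝ) (_ : z = x + t * y) (_ : 0 < f x) (_ : 0 < V y),
      ENNReal.ofReal ((f x ^ γ + t * V y) ^ (1 / γ))

/-!
Write `f = F ∘ w` with `F w = w ^ (1 / γ)`, `w = f ^ γ` if `γ < 0`, and `F w = exp (-w)`,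
`w = -log f` if `γ = 0`. In both cases `F` is convex, decreasing, and tends to `0` at infinity, so
that `F w = ∫ (c - w)₊ F''(c) dc` (`lintegral_hinge_mul`). Suprema commute with this superposition
(`layeredSup_eq_lintegral`): `h_t = ∫ Q_t a_c F''(c) dc`, where `a_c = (c - w)₊` and
`Q_t a (z) = sup_y (a (z - t y) - t V y)` is the sup-convolution `supConv`. By Tonelli it is enough
that `t ↦ ∫ Q_t a` is concave for every continuous `a ≥ 0` of compact support; the tent truncations
`min f (n - |x|)₊` and monotone convergence reduce general `f` to compactly supported ones.

For `s < t` put `T = t - s`, `g = Q_s a`, `u = Q_t a`, `h = Q_{(1 - θ) s + θ t} a` and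
`v d = T V (d / T)`. Convexity of `V` gives `h ((1 - θ) x + θ z) ≥ g x - θ v (z - x)` for all
`x, z`, and `u z = max_x (g x - v (z - x))`. As `v` is convex, the greatest maximizer `X z` is
monotone in `z` (`exists_monotoneOn_maximizer`). The integral of `h` is computed along a staircase
in the `(x, z)`-plane with corners on the graph of `X`. On a horizontal stair the lower bound for
`h` contributes `(1 - θ) ∫ g` and on a vertical one `θ ∫ u`, up to an error that vanishes as the
stairs shrink; the remaining terms are `θ (1 - θ)` times the increment of a primitive of `v`
evaluated at `z - x` (`integral_staircase_step`). They telescope, and vanish in total because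
`z = x` at both ends, which lie outside the supports. This one-dimensional cancellation is why no
concavity of `f` is needed.
-/

open MeasureTheory Set Filter Topology

/-! ### A staircase inequality for sup-convolutions on the line -/

/-- The bound for `∫ h` along a horizontal segment from `(x, z)` to `(x', z)` followed by a vertical
one to `(x', z')`. The point `x'` has to be optimal, up to `ε`, for the targets in `[z, z']`, while
nothing is asked of `x`. The last term is the increment of a primitive of `v` along the path. -/
theorem integral_staircase_step {g u h v : ℝ → ℝ} {θ : ℝ} (hg : Continuous g) (hu : Continuous u)
    (hh : Continuous h) (hv : Continuous v) (hθ0 : 0 ≤ θ) (hθ1 : θ ≤ 1)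
    (hle : ∀ x z, g x - θ * v (z - x) ≤ h ((1 - θ) * x + θ * z))
    {x x' z z' ε : ℝ} (hx : x ≤ x') (hz : z ≤ z')
    (hopt : ∀ ζ ∈ Icc z z', u ζ + v (ζ - x') - ε ≤ g x') :
    (1 - θ) * (∫ ξ in x..x', g ξ) + θ * (∫ ζ in z..z', u ζ) - θ * ε * (z' - z)
      + θ * (1 - θ) * ((∫ d in (0 : ℝ)..(z' - x'), v d) - ∫ d in (0 : ℝ)..(z - x), v d)
      ≤ ∫ m in ((1 - θ) * x + θ * z)..((1 - θ) * x' + θ * z'), h m := by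
  have e1 : (1 - θ) * (∫ ξ in x..x', h ((1 - θ) * ξ + θ * z))
      = ∫ m in ((1 - θ) * x + θ * z)..((1 - θ) * x' + θ * z), h m :=
    intervalIntegral.mul_integral_comp_mul_add _ _
  have e2 : θ * (∫ ζ in z..z', h (θ * ζ + (1 - θ) * x'))
      = ∫ m in ((1 - θ) * x' + θ * z)..((1 - θ) * x' + θ * z'), h m := by
    rw [intervalIntegral.mul_integral_comp_mul_add]; simp only [add_comm]
  have e3 : (∫ m in ((1 - θ) * x + θ * z)..((1 - θ) * x' + θ * z), h m)
      + (∫ m in ((1 - θ) * x' + θ * z)..((1 - θ) * x' + θ * z'), h m)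
      = ∫ m in ((1 - θ) * x + θ * z)..((1 - θ) * x' + θ * z'), h m :=
    intervalIntegral.integral_add_adjacent_intervals (hh.intervalIntegrable _ _)
      (hh.intervalIntegrable _ _)
  have w1 : (∫ ξ in x..x', v (z - ξ)) = ∫ d in (z - x')..(z - x), v d :=
    intervalIntegral.integral_comp_sub_left _ _
  have w2 : (∫ ζ in z..z', v (ζ - x')) = ∫ d in (z - x')..(z' - x'), v d :=
    intervalIntegral.integral_comp_sub_right _ _
  have w3 := intervalIntegral.integral_add_adjacent_intervals
    (hv.intervalIntegrable (μ := volume) 0 (z - x')) (hv.intervalIntegrable (z - x') (z - x))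
  have w4 := intervalIntegral.integral_add_adjacent_intervals
    (hv.intervalIntegrable (μ := volume) 0 (z - x')) (hv.intervalIntegrable (z - x') (z' - x'))
  have i1 : (∫ ξ in x..x', g ξ) - θ * (∫ ξ in x..x', v (z - ξ))
      ≤ ∫ ξ in x..x', h ((1 - θ) * ξ + θ * z) := by
    rw [← intervalIntegral.integral_const_mul, ← intervalIntegral.integral_sub
      (hg.intervalIntegrable _ _) (Continuous.intervalIntegrable (by fun_prop) _ _)]
    refine intervalIntegral.integral_mono_on hx (Continuous.intervalIntegrable (by fun_prop) _ _)
      (Continuous.intervalIntegrable (by fun_prop) _ _) fun ξ _ => hle ξ z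
  have i2 : (∫ ζ in z..z', u ζ) + (1 - θ) * (∫ ζ in z..z', v (ζ - x')) - ε * (z' - z)
      ≤ ∫ ζ in z..z', h (θ * ζ + (1 - θ) * x') := by
    have : ε * (z' - z) = ∫ _ in z..z', ε := by simp [mul_comm]
    rw [this, ← intervalIntegral.integral_const_mul, ← intervalIntegral.integral_add
      (hu.intervalIntegrable _ _) (Continuous.intervalIntegrable (by fun_prop) _ _),
      ← intervalIntegral.integral_sub (Continuous.intervalIntegrable (by fun_prop) _ _)
        (Continuous.intervalIntegrable (by fun_prop) _ _)]
    refine intervalIntegral.integral_mono_on hz (Continuous.intervalIntegrable (by fun_prop) _ _)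
      (Continuous.intervalIntegrable (by fun_prop) _ _) fun ζ hζ => ?_
    have h1 := hle x' ζ
    have h2 := hopt ζ hζ
    rw [add_comm (θ * ζ)]
    linarith
  have j1 := mul_le_mul_of_nonneg_left i1 (sub_nonneg.2 hθ1)
  have j2 := mul_le_mul_of_nonneg_left i2 hθ0
  rw [e1, w1] at j1
  rw [e2, w2] at j2
  rw [← e3, ← w3, ← w4]
  nlinarith [j1, j2]

/-- Uncrossing two segments does not increase a convex transport cost on the line. -/
theorem ConvexOn.exchange {v : ℝ → ℝ} (hv : ConvexOn ℝ univ v) {x x' z z' : ℝ}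
    (hx : x' ≤ x) (hz : z ≤ z') :
    v (z - x') + v (z' - x) ≤ v (z - x) + v (z' - x') := by
  rcases (add_nonneg (sub_nonneg.2 hx) (sub_nonneg.2 hz)).eq_or_lt with h0 | h0
  · have h1 : x' = x := by linarith
    have h2 : z = z' := by linarith
    subst h1 h2; rfl
  set D := x - x' + (z' - z) with hD
  have a0 : 0 ≤ (x - x') / D := div_nonneg (sub_nonneg.2 hx) h0.le
  have b0 : 0 ≤ (z' - z) / D := div_nonneg (sub_nonneg.2 hz) h0.le
  have ab : (x - x') / D + (z' - z) / D = 1 := by rw [← add_div]; exact div_self h0.ne'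
  have h1 := hv.2 (mem_univ (z - x)) (mem_univ (z' - x')) b0 a0 (by linarith)
  have h2 := hv.2 (mem_univ (z - x)) (mem_univ (z' - x')) a0 b0 ab
  simp only [smul_eq_mul] at h1 h2
  have p1 : (z' - z) / D * (z - x) + (x - x') / D * (z' - x') = z - x' := by
    field_simp; rw [hD]; ring
  have p2 : (x - x') / D * (z - x) + (z' - z) / D * (z' - x') = z' - x := by
    field_simp; rw [hD]; ring
  rw [p1] at h1
  rw [p2] at h2
  have q1 : (x - x') / D = 1 - (z' - z) / D := by linarith
  rw [q1] at h1 h2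
  linarith

theorem exists_monotoneOn_maximizer {g u v : ℝ → ℝ} {R : ℝ} (hg : Continuous g)
    (hv : Continuous v) (hconv : ConvexOn ℝ univ v) (hv0 : v 0 = 0)
    (hle : ∀ x z, g x - v (z - x) ≤ u z)
    (hex : ∀ z ∈ Icc (-R) R, ∃ x ∈ Icc (-R) R, u z ≤ g x - v (z - x))
    (hR : 0 ≤ R) (huR : u R ≤ g R) :
    ∃ X : ℝ → ℝ, MonotoneOn X (Icc (-R) R) ∧ X R = R ∧
      ∀ z ∈ Icc (-R) R, X z ∈ Icc (-R) R ∧ u z ≤ g (X z) - v (z - X z) := by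
  have key : ∀ z, ∃ x, z ∈ Icc (-R) R →
      IsGreatest {x | x ∈ Icc (-R) R ∧ u z ≤ g x - v (z - x)} x := by
    intro z
    by_cases hz : z ∈ Icc (-R) R
    · have hc : IsCompact {x | x ∈ Icc (-R) R ∧ u z ≤ g x - v (z - x)} :=
        isCompact_Icc.inter_right
          (isClosed_le continuous_const (hg.sub (hv.comp (continuous_const.sub continuous_id))))
      obtain ⟨x, hx⟩ := hc.exists_isGreatest (hex z hz)
      exact ⟨x, fun _ => hx⟩
    · exact ⟨0, fun h => absurd h hz⟩
  choose X hX using key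
  refine ⟨X, fun z hz z' hz' hzz => ?_, ?_, fun z hz => (hX z hz).1⟩
  · by_contra! hlt
    refine hlt.not_ge ((hX z' hz').2 ⟨(hX z hz).1.1, ?_⟩)
    have h1 := (hX z hz).1.2
    have h2 := (hX z' hz').1.2
    have h3 := hle (X z') z
    have h4 := hconv.exchange hlt.le hzz
    linarith
  · have hRm : R ∈ Icc (-R) R := ⟨by linarith, le_rfl⟩
    exact le_antisymm (hX R hRm).1.1.2 ((hX R hRm).2 ⟨hRm, by simpa [hv0] using huR⟩)

/-- The integral inequality for `g`, its sup-convolution `u` with cost `v`, and any function `h`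
above the intermediate sup-convolution. The window `[-R, R]` is preserved by maximizers, and its end
point `R` is its own maximizer by `huR`. -/
theorem integral_concave_of_sup_convolution {g u h v : ℝ → ℝ} {θ R : ℝ} (hg : Continuous g)
    (hu : Continuous u) (hh : Continuous h) (hv : Continuous v) (hconv : ConvexOn ℝ univ v)
    (hv0 : v 0 = 0) (hθ0 : 0 ≤ θ) (hθ1 : θ ≤ 1)
    (hmid : ∀ x z, g x - θ * v (z - x) ≤ h ((1 - θ) * x + θ * z))
    (hle : ∀ x z, g x - v (z - x) ≤ u z)
    (hex : ∀ z ∈ Icc (-R) R, ∃ x ∈ Icc (-R) R, u z ≤ g x - v (z - x))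
    (hR : 0 < R) (huR : u R ≤ g R) :
    (1 - θ) * (∫ x in (-R)..R, g x) + θ * (∫ z in (-R)..R, u z) ≤ ∫ m in (-R)..R, h m := by
  obtain ⟨X, hXm, hXR, hX⟩ := exists_monotoneOn_maximizer hg hv hconv hv0 hle hex hR.le huR
  have approx : ∀ ε > 0, (1 - θ) * (∫ x in (-R)..R, g x) + θ * (∫ z in (-R)..R, u z)
      ≤ (∫ m in (-R)..R, h m) + θ * ε * (R - -R) := by
    intro ε hε
    have uc1 := (isCompact_Icc (a := -R) (b := R)).uniformContinuousOn_of_continuous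
      hu.continuousOn
    have uc2 := (isCompact_Icc (a := -(2 * R)) (b := 2 * R)).uniformContinuousOn_of_continuous
      hv.continuousOn
    rw [Metric.uniformContinuousOn_iff] at uc1 uc2
    obtain ⟨δ1, hδ1, H1⟩ := uc1 (ε / 2) (half_pos hε)
    obtain ⟨δ2, hδ2, H2⟩ := uc2 (ε / 2) (half_pos hε)
    -- On stairs shorter than `δ1` and `δ2`, both `u` and `v` vary by at most `ε / 2`.
    obtain ⟨n, hn⟩ := exists_nat_gt (2 * R / min δ1 δ2)
    have hδ : 0 < min δ1 δ2 := lt_min hδ1 hδ2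
    have hn0 : (0 : ℝ) < n := lt_trans (by positivity) hn
    set Z : ℕ → ℝ := fun k => -R + k * (2 * R / n) with hZ
    have hstep : 0 < 2 * R / n := by positivity
    have hstep' : 2 * R / n < min δ1 δ2 := by
      rw [div_lt_iff₀ hδ] at hn
      rw [div_lt_iff₀ hn0]; linarith
    have Z0 : Z 0 = -R := by simp [hZ]
    have Zn : Z n = R := by simp only [hZ]; field_simp; ring
    have Zs : ∀ k, Z (k + 1) = Z k + 2 * R / n := by intro k; simp only [hZ]; push_cast; ring
    have Zmono : Monotone Z := monotone_nat_of_le_succ fun k => by rw [Zs]; linarith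
    have Zmem : ∀ k ≤ n, Z k ∈ Icc (-R) R := fun k hk =>
      ⟨Z0 ▸ Zmono (Nat.zero_le k), Zn ▸ Zmono hk⟩
    -- The staircase starts at `(-R, -R)`, which need not be an optimal pair.
    set Y : ℕ → ℝ := fun k => if k = 0 then -R else X (Z k) with hY
    have Ystep : ∀ k < n, Y k ≤ Y (k + 1) := by
      intro k hk
      rcases Nat.eq_zero_or_pos k with rfl | h0
      · simpa [hY] using (hX _ (Zmem 1 hk)).1.1
      · simp only [hY, h0.ne', if_false, Nat.succ_ne_zero]
        exact hXm (Zmem k hk.le) (Zmem _ hk) (Zmono (Nat.le_succ k))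
    have main : ∀ k ≤ n, (1 - θ) * (∫ x in (-R)..(Y k), g x) + θ * (∫ z in (-R)..(Z k), u z)
        - θ * ε * (Z k - -R) + θ * (1 - θ) * (∫ d in (0 : ℝ)..(Z k - Y k), v d)
        ≤ ∫ m in (-R)..((1 - θ) * Y k + θ * Z k), h m := by
      intro k
      induction k with
      | zero =>
        intro _
        have e : (1 - θ) * -R + θ * -R = -R := by ring
        simp [hY, Z0, -mul_neg, e]
      | succ k ih =>
        intro hk
        have hk' : k < n := hk
        have hopt : ∀ ζ ∈ Icc (Z k) (Z (k + 1)),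
            u ζ + v (ζ - Y (k + 1)) - ε ≤ g (Y (k + 1)) := by
          intro ζ hζ
          have hζR : ζ ∈ Icc (-R) R :=
            ⟨(Zmem k hk'.le).1.trans hζ.1, hζ.2.trans (Zmem _ hk).2⟩
          have hYe : Y (k + 1) = X (Z (k + 1)) := by simp [hY]
          obtain ⟨hm, ho⟩ := hX _ (Zmem _ hk)
          rw [← hYe] at hm ho
          have hZm := Zmem _ hk
          have hd : |ζ - Z (k + 1)| < min δ1 δ2 := by
            rw [abs_sub_comm, abs_of_nonneg (by linarith [hζ.2])]
            have := Zs k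
            linarith [hζ.1]
          have a1 := H1 ζ hζR _ hZm (by
            rw [Real.dist_eq]; exact hd.trans_le (min_le_left _ _))
          have a2 := H2 (ζ - Y (k + 1)) ⟨by linarith [hζR.1, hm.2], by linarith [hζR.2, hm.1]⟩
            (Z (k + 1) - Y (k + 1)) ⟨by linarith [hZm.1, hm.2], by linarith [hZm.2, hm.1]⟩ (by
            rw [Real.dist_eq]
            have : ζ - Y (k + 1) - (Z (k + 1) - Y (k + 1)) = ζ - Z (k + 1) := by ring
            rw [this]; exact hd.trans_le (min_le_right _ _))
          rw [Real.dist_eq, abs_lt] at a1 a2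
          linarith [a1.2, a2.2]
        have st := integral_staircase_step hg hu hh hv hθ0 hθ1 hmid (Ystep k hk')
          (Zmono (Nat.le_succ k)) hopt
        have ih' := ih hk'.le
        rw [← intervalIntegral.integral_add_adjacent_intervals
            (hg.intervalIntegrable (-R) (Y k)) (hg.intervalIntegrable (Y k) (Y (k + 1))),
          ← intervalIntegral.integral_add_adjacent_intervals
            (hu.intervalIntegrable (-R) (Z k)) (hu.intervalIntegrable (Z k) (Z (k + 1))),
          ← intervalIntegral.integral_add_adjacent_intervals
            (hh.intervalIntegrable (-R) ((1 - θ) * Y k + θ * Z k))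
            (hh.intervalIntegrable ((1 - θ) * Y k + θ * Z k) _)]
        linarith
    have hn' : n ≠ 0 := by rintro rfl; simp at hn0
    have fin := main n le_rfl
    have Yn : Y n = R := by simp [hY, hn', Zn, hXR]
    have e : (1 - θ) * R + θ * R = R := by ring
    rw [Yn, Zn, e, sub_self, intervalIntegral.integral_same] at fin
    linarith
  refine le_of_forall_pos_le_add fun η hη => ?_
  have hK : 0 < θ * (R - -R) + 1 := by nlinarith
  refine (approx (η / (θ * (R - -R) + 1)) (by positivity)).trans ?_
  have : θ * (η / (θ * (R - -R) + 1)) * (R - -R) ≤ η := by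
    rw [show θ * (η / (θ * (R - -R) + 1)) * (R - -R)
      = η * ((θ * (R - -R)) / (θ * (R - -R) + 1)) by ring]
    exact mul_le_of_le_one_right hη.le ((div_le_one hK).2 (by linarith))
  linarith

/-! ### Sup-convolutions of compactly supported functions -/

/-- A continuous, nonnegative convex cost on the line that vanishes at the origin and grows at least
linearly. -/
structure IsConvexPotential (V : ℝ → ℝ) : Prop where
  continuous : Continuous V
  convex : ConvexOn ℝ univ V
  zero : V 0 = 0
  nonneg : ∀ y, 0 ≤ V y
  coercive : ∃ κ > 0, ∀ y, 1 ≤ |y| → κ * |y| ≤ V y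

/-- The Hopf–Lax sup-convolution `Q_t a (z) = sup_y (a (z - t y) - t V y)`. The supremum is over the
velocity `y`, so that `Q_0 a = a` without a division by `t`. It is a real supremum, hence meaningful
only where `a` is bounded above. -/
noncomputable def supConv (V a : ℝ → ℝ) (t z : ℝ) : ℝ := ⨆ y : ℝ, (a (z - t * y) - t * V y)

/-- Convexity of `V` in perspective form: moving at constant speed is cheapest. -/
theorem IsConvexPotential.add_le {V : ℝ → ℝ} (hV : IsConvexPotential V) {s r : ℝ} (hs : 0 ≤ s)
    (hr : 0 ≤ r) (hsr : 0 < s + r) (y y' : ℝ) :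
    (s + r) * V ((s * y' + r * y) / (s + r)) ≤ s * V y' + r * V y := by
  have h := hV.convex.2 (mem_univ y') (mem_univ y) (div_nonneg hs hsr.le)
    (div_nonneg hr hsr.le) (by rw [← add_div]; exact div_self hsr.ne')
  simp only [smul_eq_mul] at h
  have e : s / (s + r) * y' + r / (s + r) * y = (s * y' + r * y) / (s + r) := by ring
  rw [e] at h
  have := mul_le_mul_of_nonneg_left h hsr.le
  refine this.trans_eq ?_
  field_simp

section supConv

variable {V a : ℝ → ℝ} {t s M r : ℝ}

theorem le_supConv (hV : IsConvexPotential V) (haM : ∀ x, a x ≤ M) (ht : 0 ≤ t) (z y : ℝ) :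
    a (z - t * y) - t * V y ≤ supConv V a t z := by
  refine le_ciSup (f := fun y => a (z - t * y) - t * V y) ⟨M, ?_⟩ y
  rintro _ ⟨y, rfl⟩
  have := mul_nonneg ht (hV.nonneg y)
  have := haM (z - t * y)
  simp only
  linarith

theorem self_le_supConv (hV : IsConvexPotential V) (haM : ∀ x, a x ≤ M) (ht : 0 ≤ t) (z : ℝ) :
    a z ≤ supConv V a t z := by
  simpa [hV.zero] using le_supConv hV haM ht z 0

/-- Sup-convolution enlarges a support contained in `[-r, r]` by a bounded amount: a trajectory
reaching further has speed at least `1`, so by coercivity it costs at least `M ≥ sup a`. -/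
theorem supConv_eq_zero (hV : IsConvexPotential V) (haM : ∀ x, a x ≤ M) (ha0 : ∀ x, 0 ≤ a x)
    (hr : ∀ x, r ≤ |x| → a x = 0) {κ : ℝ} (hκ : 0 < κ) (hVκ : ∀ y, 1 ≤ |y| → κ * |y| ≤ V y)
    (ht : 0 ≤ t) {z : ℝ} (hz : r + M / κ + t + 1 ≤ |z|) : supConv V a t z = 0 := by
  refine le_antisymm (ciSup_le fun y => ?_) ((ha0 z).trans (self_le_supConv hV haM ht z))
  have htV := mul_nonneg ht (hV.nonneg y)
  by_cases h : r ≤ |z - t * y|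
  · rw [hr _ h]; linarith
  · push Not at h
    have h1 : |z| ≤ |z - t * y| + t * |y| := by
      have := abs_add_le (z - t * y) (t * y)
      rwa [sub_add_cancel, abs_mul, abs_of_nonneg ht] at this
    have hM : 0 ≤ M := (ha0 0).trans (haM 0)
    have hMκ : 0 ≤ M / κ := div_nonneg hM hκ.le
    have hty : M / κ + t + 1 ≤ t * |y| := by linarith
    have hy : 1 ≤ |y| := by
      by_contra! hy
      nlinarith
    have h2 := mul_le_mul_of_nonneg_left (hVκ y hy) ht
    have h3 : M = κ * (M / κ) := by field_simp
    have h4 := haM (z - t * y)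
    nlinarith

theorem continuous_supConv (hV : IsConvexPotential V) (haM : ∀ x, a x ≤ M)
    (hau : UniformContinuous a) (ht : 0 ≤ t) : Continuous (supConv V a t) := by
  have half : ∀ ε > 0, ∃ δ > 0, ∀ z w, |z - w| < δ →
      supConv V a t z ≤ supConv V a t w + ε := by
    intro ε hε
    obtain ⟨δ, hδ, H⟩ := Metric.uniformContinuous_iff.1 hau ε hε
    refine ⟨δ, hδ, fun z w hzw => ciSup_le fun y => ?_⟩
    have h1 := H (a := z - t * y) (b := w - t * y) (by simpa [Real.dist_eq] using hzw)
    rw [Real.dist_eq, abs_lt] at h1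
    have h2 := le_supConv hV haM ht w y
    linarith [h1.2]
  rw [Metric.continuous_iff]
  intro w ε hε
  obtain ⟨δ, hδ, H⟩ := half (ε / 2) (half_pos hε)
  refine ⟨δ, hδ, fun z hz => ?_⟩
  rw [Real.dist_eq] at hz ⊢
  have h1 := H z w hz
  have h2 := H w z (by rwa [abs_sub_comm])
  rw [abs_lt]
  constructor <;> linarith

theorem exists_eq_supConv (hV : IsConvexPotential V) (ha : Continuous a) (ha0 : ∀ x, 0 ≤ a x)
    (hr : ∀ x, r ≤ |x| → a x = 0) (ht : 0 < t) (z : ℝ) :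
    ∃ y, supConv V a t z ≤ a (z - t * y) - t * V y := by
  set Y := (|z| + |r|) / t
  have hY : 0 ≤ Y := by positivity
  have hc : Continuous fun y => a (z - t * y) - t * V y := by
    have := hV.continuous
    fun_prop
  obtain ⟨y, -, hy⟩ := (isCompact_Icc (a := -Y) (b := Y)).exists_isMaxOn
    ⟨0, by simpa using hY⟩ hc.continuousOn
  refine ⟨y, ciSup_le fun w => ?_⟩
  by_cases hw : w ∈ Icc (-Y) Y
  · exact hy hw
  · have h0 := hy (show (0 : ℝ) ∈ Icc (-Y) Y by simpa using hY)
    simp only [mem_ofPred_eq, mul_zero, sub_zero, hV.zero] at h0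
    have hw' : Y < |w| := by
      by_contra! h
      exact hw (abs_le.1 h)
    have h1 : |z| + |r| < t * |w| := by
      have := (div_lt_iff₀ ht).1 hw'
      linarith
    have h2 : t * |w| ≤ |z - t * w| + |z| := by
      have := abs_sub (z - t * w) z
      rwa [show z - t * w - z = -(t * w) by ring, abs_neg, abs_mul, abs_of_pos ht] at this
    rw [hr _ (by linarith [le_abs_self r])]
    have := mul_nonneg ht.le (hV.nonneg w)
    linarith [ha0 z]

/-- The half `Q_r (Q_s a) ≤ Q_{s + r} a` of the semigroup property. -/
theorem supConv_sub_le_supConv_add (hV : IsConvexPotential V) (haM : ∀ x, a x ≤ M) (hs : 0 ≤ s)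
    (hr : 0 < r) (x y : ℝ) :
    supConv V a s x - r * V y ≤ supConv V a (s + r) (x + r * y) := by
  rw [sub_le_iff_le_add]
  refine ciSup_le fun y' => ?_
  have hsr : 0 < s + r := by linarith
  have h1 := hV.add_le hs hr.le hsr y y'
  have h2 := le_supConv hV haM hsr.le (x + r * y) ((s * y' + r * y) / (s + r))
  rw [show x + r * y - (s + r) * ((s * y' + r * y) / (s + r)) = x - s * y' by
    field_simp; ring] at h2
  linarith

end supConv

theorem lintegral_ofReal_eq_intervalIntegral {F : ℝ → ℝ} {R : ℝ} (hF : Continuous F)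
    (h0 : ∀ x, 0 ≤ F x) (hR : ∀ x, R ≤ |x| → F x = 0) :
    ∫⁻ x, ENNReal.ofReal (F x) = ENNReal.ofReal (∫ x in (-R)..R, F x) := by
  have hcs : HasCompactSupport F := HasCompactSupport.intro (isCompact_Icc (a := -R) (b := R))
    fun x hx => hR x (by
      by_contra! h
      exact hx (abs_le.1 h.le))
  rw [intervalIntegral.integral_eq_integral_of_support_subset,
    ofReal_integral_eq_lintegral_ofReal (hF.integrable_of_hasCompactSupport hcs)
      (Eventually.of_forall h0)]
  intro x hx
  have : |x| < R := by
    by_contra! h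
    exact hx (hR x h)
  exact ⟨(abs_lt.1 this).1, (abs_lt.1 this).2.le⟩

theorem lintegral_supConv_concave {V a : ℝ → ℝ} (hV : IsConvexPotential V) (ha : Continuous a)
    (ha0 : ∀ x, 0 ≤ a x) (hc : HasCompactSupport a) {s t θ : ℝ} (hs : 0 ≤ s) (hst : s < t)
    (hθ0 : 0 < θ) (hθ1 : θ ≤ 1) :
    ENNReal.ofReal (1 - θ) * (∫⁻ z, ENNReal.ofReal (supConv V a s z))
      + ENNReal.ofReal θ * (∫⁻ z, ENNReal.ofReal (supConv V a t z))
      ≤ ∫⁻ z, ENNReal.ofReal (supConv V a ((1 - θ) * s + θ * t) z) := by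
  obtain ⟨M, hM'⟩ := hc.exists_bound_of_continuous ha
  have hM : ∀ x, a x ≤ M := fun x => (le_abs_self _).trans (hM' x)
  obtain ⟨ρ, hρ⟩ := hc.isCompact.isBounded.subset_closedBall (0 : ℝ)
  have hr : ∀ x, ρ + 1 ≤ |x| → a x = 0 := by
    intro x hx
    by_contra h
    have := hρ (subset_tsupport a h)
    rw [mem_closedBall_zero_iff, Real.norm_eq_abs] at this
    linarith
  obtain ⟨κ, hκ, hVκ⟩ := hV.coercive
  have hau := hc.uniformContinuous_of_continuous ha
  have ht : 0 < t := hs.trans_lt hst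
  set T := t - s with hT
  have hT0 : 0 < T := sub_pos.2 hst
  have hm : (1 - θ) * s + θ * t = s + θ * T := by rw [hT]; ring
  rw [hm]
  have hm0 : 0 ≤ s + θ * T := by positivity
  have hmt : s + θ * T ≤ t := by rw [hT]; nlinarith
  set R := max (ρ + 1 + M / κ + t + 1) 1 with hRdef
  have hR0 : 0 < R := lt_max_of_lt_right one_pos
  have vanish : ∀ τ, 0 ≤ τ → τ ≤ t → ∀ x, R ≤ |x| → supConv V a τ x = 0 := fun τ h0 h1 x hx =>
    supConv_eq_zero hV hM ha0 hr hκ hVκ h0 (by linarith [le_max_left (ρ + 1 + M / κ + t + 1) 1])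
  have cont : ∀ τ, 0 ≤ τ → Continuous (supConv V a τ) := fun τ h0 =>
    continuous_supConv hV hM hau h0
  have nonneg : ∀ τ, 0 ≤ τ → ∀ x, 0 ≤ supConv V a τ x := fun τ h0 x =>
    (ha0 x).trans (self_le_supConv hV hM h0 x)
  rw [lintegral_ofReal_eq_intervalIntegral (cont s hs) (nonneg s hs) (vanish s hs hst.le),
    lintegral_ofReal_eq_intervalIntegral (cont t ht.le) (nonneg t ht.le) (vanish t ht.le le_rfl),
    lintegral_ofReal_eq_intervalIntegral (cont _ hm0) (nonneg _ hm0) (vanish _ hm0 hmt),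
    ← ENNReal.ofReal_mul (sub_nonneg.2 hθ1), ← ENNReal.ofReal_mul hθ0.le]
  have hint : ∀ τ, 0 ≤ τ → 0 ≤ ∫ x in (-R)..R, supConv V a τ x := fun τ h0 =>
    intervalIntegral.integral_nonneg (by linarith) fun x _ => nonneg τ h0 x
  rw [← ENNReal.ofReal_add (mul_nonneg (sub_nonneg.2 hθ1) (hint s hs))
    (mul_nonneg hθ0.le (hint t ht.le))]
  refine ENNReal.ofReal_le_ofReal ?_
  have hVc := hV.continuous
  -- Between the times `s` and `t`, displacing a point by `d` costs `(t - s) V(d / (t - s))`.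
  have hmid : ∀ η, 0 < η → ∀ x z, supConv V a s x - η * (T * V ((z - x) / T))
      ≤ supConv V a (s + η * T) ((1 - η) * x + η * z) := by
    intro η h0 x z
    have := supConv_sub_le_supConv_add hV hM hs (mul_pos h0 hT0) x ((z - x) / T)
    rw [show x + η * T * ((z - x) / T) = (1 - η) * x + η * z by field_simp; ring] at this
    linarith
  have hle : ∀ x z, supConv V a s x - T * V ((z - x) / T) ≤ supConv V a t z := by
    intro x z
    have := hmid 1 one_pos x z
    rw [one_mul, one_mul, one_mul, sub_self, zero_mul, zero_add,
      show s + T = t by rw [hT]; ring] at this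
    exact this
  refine integral_concave_of_sup_convolution (v := fun d => T * V (d / T)) (cont s hs)
    (cont t ht.le) (cont _ hm0) (by fun_prop) ?_ (by simp [hV.zero]) hθ0.le hθ1
    (hmid θ hθ0) hle ?_ hR0 ?_
  · refine ⟨convex_univ, fun x _ y _ b c hb hc hbc => ?_⟩
    have := hV.convex.2 (mem_univ (x / T)) (mem_univ (y / T)) hb hc hbc
    simp only [smul_eq_mul] at this ⊢
    rw [show (b * x + c * y) / T = b * (x / T) + c * (y / T) by ring]
    have := mul_le_mul_of_nonneg_left this hT0.le
    linarith
  · intro z hz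
    obtain ⟨y, hy⟩ := exists_eq_supConv hV ha ha0 hr ht z
    -- The maximal trajectory ending at `z` at time `t` is at `z - T y` at time `s`.
    have h1 : supConv V a t z ≤ supConv V a s (z - T * y) - T * V y := by
      have := le_supConv hV hM hs (z - T * y) y
      rw [show z - T * y - s * y = z - t * y by rw [hT]; ring] at this
      have e : t * V y = T * V y + s * V y := by rw [hT]; ring
      linarith
    -- If that point leaves the window then `u z = 0`, and `z` itself is a maximizer.
    by_cases hx : R ≤ |z - T * y|
    · refine ⟨z, hz, ?_⟩
      rw [vanish s hs hst.le _ hx] at h1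
      have := mul_nonneg hT0.le (hV.nonneg y)
      have := nonneg s hs z
      simp only [sub_self, zero_div, hV.zero, mul_zero, sub_zero]
      linarith
    · push Not at hx
      refine ⟨z - T * y, abs_le.1 hx.le, ?_⟩
      rwa [sub_sub_cancel, mul_div_cancel_left₀ _ hT0.ne']
  · have hRabs : R ≤ |R| := le_abs_self R
    rw [vanish s hs hst.le _ hRabs, vanish t ht.le le_rfl _ hRabs]

/-! ### Superposition of hinges -/

/-- A continuous antitone function on `(0, ∞)` that is unbounded above, hence tends to `+∞` at `0`.
Its values outside `(0, ∞)` play no role. -/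
structure IsProfile (φ : ℝ → ℝ) : Prop where
  continuousOn : ContinuousOn φ (Ioi 0)
  antitoneOn : AntitoneOn φ (Ioi 0)
  unbounded : ∀ c, ∃ δ > 0, c ≤ φ δ

/-- The layer `a_c = (c - φ ∘ f)₊`, where `φ ∘ f` counts as `+∞` at the points with `f x ≤ 0`. -/
noncomputable def profileLayer (φ f : ℝ → ℝ) (c x : ℝ) : ℝ :=
  if 0 < f x then max (c - φ (f x)) 0 else 0

/-- The supremum over `z = x + t y` with `f x > 0` of `F (φ (f x) + t V y)`, where
`F w = ∫ (c - w)₊ k c dc`. The variable `x` is eliminated as `z - t y`. -/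
noncomputable def layeredSup (k : ℝ → ℝ≥0∞) (φ V f : ℝ → ℝ) (t z : ℝ) : ℝ≥0∞ :=
  ⨆ (y : ℝ) (_ : 0 < f (z - t * y)),
    ∫⁻ c, ENNReal.ofReal (c - (φ (f (z - t * y)) + t * V y)) * k c

section layer

variable {φ f : ℝ → ℝ}

theorem profileLayer_nonneg (c x : ℝ) : 0 ≤ profileLayer φ f c x := by
  unfold profileLayer
  split_ifs
  exacts [le_max_right _ _, le_rfl]

theorem profileLayer_mono (x : ℝ) : Monotone fun c => profileLayer φ f c x := by
  intro c d h
  simp only [profileLayer]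
  split_ifs
  exacts [max_le_max (by linarith) le_rfl, le_rfl]

/-- Below a level `δ` with `φ δ ≥ c` the layer vanishes, so that `f` can be replaced by `max f δ`,
which stays in the domain where `φ` is continuous. -/
theorem profileLayer_eq_max (hφ : IsProfile φ) {c δ : ℝ} (hδ : 0 < δ) (hc : c ≤ φ δ) (x : ℝ) :
    profileLayer φ f c x = max (c - φ (max (f x) δ)) 0 := by
  unfold profileLayer
  rcases le_total (f x) δ with h | h
  · rw [max_eq_right h, max_eq_right (sub_nonpos.2 hc)]
    split_ifs with h0
    · exact max_eq_right (sub_nonpos.2 (hc.trans (hφ.antitoneOn h0 hδ h)))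
    · rfl
  · rw [if_pos (hδ.trans_le h), max_eq_left h]

theorem continuous_profileLayer (hφ : IsProfile φ) (hf : Continuous f) (c : ℝ) :
    Continuous (profileLayer φ f c) := by
  obtain ⟨δ, hδ, hc⟩ := hφ.unbounded c
  rw [funext (profileLayer_eq_max hφ hδ hc)]
  exact (continuous_const.sub (hφ.continuousOn.comp_continuous (hf.max continuous_const)
    fun x => lt_max_of_lt_right hδ)).max continuous_const

theorem hasCompactSupport_profileLayer (hf : HasCompactSupport f) (c : ℝ) :
    HasCompactSupport (profileLayer φ f c) := by
  refine hf.mono fun x hx h0 => hx ?_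
  simp [profileLayer, h0]

theorem profileLayer_le (hφ : IsProfile φ) {M : ℝ} (hM : ∀ x, f x ≤ M) (c x : ℝ) :
    profileLayer φ f c x ≤ max (c - φ M) 0 := by
  unfold profileLayer
  split_ifs with h
  · exact max_le_max (by linarith [hφ.antitoneOn h (h.trans_le (hM x)) (hM x)]) le_rfl
  · exact le_max_right _ _

end layer

section layeredSup

variable {k : ℝ → ℝ≥0∞} {φ V f : ℝ → ℝ} {t M : ℝ}

/-- The supremum commutes with the superposition of hinges, because the competitors
`w ↦ (c - w)₊` form a chain: a sequence of values `w` decreasing to the infimum realizes the supremum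
for all `c` at once. -/
theorem layeredSup_eq_lintegral (hk : Measurable k) (hφ : IsProfile φ) (hV : IsConvexPotential V)
    (hM : ∀ x, f x ≤ M) (ht : 0 ≤ t) (z : ℝ) :
    layeredSup k φ V f t z = ∫⁻ c, ENNReal.ofReal (supConv V (profileLayer φ f c) t z) * k c := by
  apply le_antisymm
  · refine iSup_le fun y => iSup_le fun hy => lintegral_mono fun c => ?_
    refine mul_le_mul_left (ENNReal.ofReal_le_ofReal ?_) _
    refine le_trans ?_ (le_supConv hV (profileLayer_le hφ hM c) ht z y)
    have : c - φ (f (z - t * y)) ≤ profileLayer φ f c (z - t * y) := by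
      rw [profileLayer, if_pos hy]; exact le_max_left _ _
    linarith
  · set S : Set ℝ := {w | ∃ y, 0 < f (z - t * y) ∧ φ (f (z - t * y)) + t * V y = w} with hS
    have hVt : ∀ y, 0 ≤ t * V y := fun y => mul_nonneg ht (hV.nonneg y)
    rcases S.eq_empty_or_nonempty with hE | hne
    · have h0 : ∀ c, supConv V (profileLayer φ f c) t z ≤ 0 := by
        refine fun c => ciSup_le fun y => ?_
        have : ¬ 0 < f (z - t * y) := fun h =>
          eq_empty_iff_forall_notMem.1 hE _ ⟨y, h, rfl⟩
        rw [profileLayer, if_neg this]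
        linarith [hVt y]
      simp [ENNReal.ofReal_of_nonpos (h0 _)]
    · have hbdd : BddBelow S := by
        refine ⟨φ M, ?_⟩
        rintro _ ⟨y, hy, rfl⟩
        linarith [hVt y, hφ.antitoneOn hy (hy.trans_le (hM _)) (hM (z - t * y))]
      obtain ⟨u, hu, hlim, huS⟩ := exists_seq_tendsto_sInf hne hbdd
      have hle : ∀ c, ENNReal.ofReal (supConv V (profileLayer φ f c) t z) * k c
          ≤ ⨆ n, ENNReal.ofReal (c - u n) * k c := by
        intro c
        have h1 : supConv V (profileLayer φ f c) t z ≤ max (c - sInf S) 0 := by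
          refine ciSup_le fun y => ?_
          have hy' := hVt y
          unfold profileLayer
          split_ifs with hy
          · have : sInf S ≤ φ (f (z - t * y)) + t * V y := csInf_le hbdd ⟨y, hy, rfl⟩
            rcases le_total (c - φ (f (z - t * y))) 0 with h | h
            · rw [max_eq_right h]
              exact le_trans (by linarith) (le_max_right _ _)
            · rw [max_eq_left h]
              exact le_trans (by linarith) (le_max_left _ _)
          · exact le_trans (by linarith) (le_max_right _ _)
        rw [← ENNReal.iSup_mul]
        refine mul_le_mul_left ?_ _
        refine (ENNReal.ofReal_le_ofReal h1).trans ?_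
        rw [ENNReal.ofReal_max, ENNReal.ofReal_zero, max_eq_left zero_le]
        refine le_of_tendsto' ((ENNReal.continuous_ofReal.tendsto _).comp (hlim.const_sub c))
          fun n => ?_
        exact le_iSup (fun n => ENNReal.ofReal (c - u n)) n
      refine (lintegral_mono hle).trans ?_
      rw [lintegral_iSup (f := fun n c => ENNReal.ofReal (c - u n) * k c) (fun n => by fun_prop)
        fun i j hij c => mul_le_mul_left (ENNReal.ofReal_le_ofReal (by linarith [hu hij])) _]
      refine iSup_le fun n => ?_
      obtain ⟨y, hy, he⟩ := huS n
      rw [← he]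
      exact le_iSup₂_of_le (f := fun y (_ : 0 < f (z - t * y)) =>
        ∫⁻ c, ENNReal.ofReal (c - (φ (f (z - t * y)) + t * V y)) * k c) y hy le_rfl

/-- Joint measurability from continuity in `z` and monotonicity in `c`. -/
theorem measurable_supConv_profileLayer (hφ : IsProfile φ) (hV : IsConvexPotential V)
    (hf : Continuous f) (hfc : HasCompactSupport f) (hM : ∀ x, f x ≤ M) (ht : 0 ≤ t) :
    Measurable (Function.uncurry fun z c => supConv V (profileLayer φ f c) t z) := by
  refine measurable_uncurry_of_continuous_of_measurable (fun c => ?_) fun z => ?_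
  · exact continuous_supConv hV (profileLayer_le hφ hM c)
      ((hasCompactSupport_profileLayer hfc c).uniformContinuous_of_continuous
        (continuous_profileLayer hφ hf c)) ht
  · refine Monotone.measurable fun c d hcd => ciSup_le fun y => ?_
    exact (sub_le_sub_right (profileLayer_mono _ hcd) _).trans
      (le_supConv hV (profileLayer_le hφ hM d) ht z y)

theorem measurable_layeredSup (hk : Measurable k) (hφ : IsProfile φ) (hV : IsConvexPotential V)
    (hf : Continuous f) (hfc : HasCompactSupport f) (hM : ∀ x, f x ≤ M) (ht : 0 ≤ t) :
    Measurable (layeredSup k φ V f t) := by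
  rw [funext (layeredSup_eq_lintegral hk hφ hV hM ht)]
  exact Measurable.lintegral_prod_right'
    (f := fun q : ℝ × ℝ => ENNReal.ofReal (supConv V (profileLayer φ f q.2) t q.1) * k q.2)
    (((measurable_supConv_profileLayer hφ hV hf hfc hM ht).ennreal_ofReal).mul
      (hk.comp measurable_snd))

theorem lintegral_lintegral_mul_swap {G : ℝ → ℝ → ℝ≥0∞} (hk : Measurable k)
    (hG : Measurable (Function.uncurry G)) :
    ∫⁻ z, ∫⁻ c, G z c * k c = ∫⁻ c, (∫⁻ z, G z c) * k c := by
  rw [lintegral_lintegral_swap (hG.mul (hk.comp measurable_snd)).aemeasurable]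
  exact lintegral_congr fun c => lintegral_mul_const _ hG.of_uncurry_right

theorem lintegral_layeredSup (hk : Measurable k) (hφ : IsProfile φ) (hV : IsConvexPotential V)
    (hf : Continuous f) (hfc : HasCompactSupport f) (hM : ∀ x, f x ≤ M) (ht : 0 ≤ t) :
    ∫⁻ z, layeredSup k φ V f t z
      = ∫⁻ c, (∫⁻ z, ENNReal.ofReal (supConv V (profileLayer φ f c) t z)) * k c := by
  rw [lintegral_congr (layeredSup_eq_lintegral hk hφ hV hM ht)]
  exact lintegral_lintegral_mul_swap hk
    (measurable_supConv_profileLayer hφ hV hf hfc hM ht).ennreal_ofReal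

theorem lintegral_layeredSup_concave_of_hasCompactSupport (hk : Measurable k) (hφ : IsProfile φ)
    (hV : IsConvexPotential V) (hf : Continuous f) (hfc : HasCompactSupport f) {s t θ : ℝ}
    (hs : 0 ≤ s) (hst : s < t) (hθ0 : 0 < θ) (hθ1 : θ ≤ 1) :
    ENNReal.ofReal (1 - θ) * (∫⁻ z, layeredSup k φ V f s z)
      + ENNReal.ofReal θ * (∫⁻ z, layeredSup k φ V f t z)
      ≤ ∫⁻ z, layeredSup k φ V f ((1 - θ) * s + θ * t) z := by
  obtain ⟨M, hM'⟩ := hfc.exists_bound_of_continuous hf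
  have hM : ∀ x, f x ≤ M := fun x => (le_abs_self _).trans (hM' x)
  have ht : 0 ≤ t := hs.trans hst.le
  have hm : 0 ≤ (1 - θ) * s + θ * t :=
    add_nonneg (mul_nonneg (sub_nonneg.2 hθ1) hs) (mul_nonneg hθ0.le ht)
  rw [lintegral_layeredSup hk hφ hV hf hfc hM hs, lintegral_layeredSup hk hφ hV hf hfc hM ht,
    lintegral_layeredSup hk hφ hV hf hfc hM hm]
  refine (add_le_add (lintegral_const_mul_le _ _) (lintegral_const_mul_le _ _)).trans
    ((le_lintegral_add _ _).trans (lintegral_mono fun c => ?_))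
  rw [← mul_assoc, ← mul_assoc, ← add_mul]
  exact mul_le_mul_left (lintegral_supConv_concave hV (continuous_profileLayer hφ hf c)
    (profileLayer_nonneg c) (hasCompactSupport_profileLayer hfc c) hs hst hθ0 hθ1) _

/-- The truncation `min f (n - |x|)₊`, of compact support, which agrees with `f` at each point for
all large `n`. -/
noncomputable def tentTruncation (f : ℝ → ℝ) (n : ℕ) (x : ℝ) : ℝ := min (f x) (max (n - |x|) 0)

theorem tentTruncation_mono (x : ℝ) : Monotone fun n => tentTruncation f n x := fun _ _ h =>
  min_le_min le_rfl (max_le_max (sub_le_sub_right (Nat.cast_le.2 h) _) le_rfl)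

theorem layeredSup_mono (hφ : IsProfile φ) {f g : ℝ → ℝ} (hfg : ∀ x, f x ≤ g x) (z : ℝ) :
    layeredSup k φ V f t z ≤ layeredSup k φ V g t z := by
  refine iSup₂_le fun y hy => ?_
  have hy' := hy.trans_le (hfg (z - t * y))
  refine le_iSup₂_of_le (f := fun y (_ : 0 < g (z - t * y)) =>
    ∫⁻ c, ENNReal.ofReal (c - (φ (g (z - t * y)) + t * V y)) * k c) y hy' ?_
  refine lintegral_mono fun c => mul_le_mul_left (ENNReal.ofReal_le_ofReal ?_) _
  linarith [hφ.antitoneOn hy hy' (hfg (z - t * y))]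

theorem layeredSup_eq_iSup (hφ : IsProfile φ) (z : ℝ) :
    layeredSup k φ V f t z = ⨆ n, layeredSup k φ V (tentTruncation f n) t z := by
  refine le_antisymm (iSup₂_le fun y hy => ?_)
    (iSup_le fun n => layeredSup_mono hφ (fun x => min_le_left _ _) z)
  obtain ⟨n, hn⟩ := exists_nat_ge (f (z - t * y) + |z - t * y|)
  have e : tentTruncation f n (z - t * y) = f (z - t * y) :=
    min_eq_left (le_max_of_le_left (by linarith))
  refine le_iSup_of_le n ?_
  refine le_iSup₂_of_le (f := fun y (_ : 0 < tentTruncation f n (z - t * y)) =>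
    ∫⁻ c, ENNReal.ofReal (c - (φ (tentTruncation f n (z - t * y)) + t * V y)) * k c) y
    (e.symm ▸ hy) ?_
  rw [e]

theorem lintegral_layeredSup_concave (hk : Measurable k) (hφ : IsProfile φ)
    (hV : IsConvexPotential V) (hf : Continuous f) (hf0 : ∀ x, 0 ≤ f x) {s t θ : ℝ}
    (hs : 0 ≤ s) (hst : s < t) (hθ0 : 0 < θ) (hθ1 : θ ≤ 1) :
    ENNReal.ofReal (1 - θ) * (∫⁻ z, layeredSup k φ V f s z)
      + ENNReal.ofReal θ * (∫⁻ z, layeredSup k φ V f t z)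
      ≤ ∫⁻ z, layeredSup k φ V f ((1 - θ) * s + θ * t) z := by
  have hc : ∀ n, Continuous (tentTruncation f n) := fun n => by
    unfold tentTruncation; fun_prop
  have hcs : ∀ n, HasCompactSupport (tentTruncation f n) := fun n =>
    HasCompactSupport.intro (isCompact_Icc (a := -(n : ℝ)) (b := n)) fun x hx => by
      have : (n : ℝ) < |x| := by
        by_contra! h
        exact hx (abs_le.1 h)
      rw [tentTruncation, max_eq_right (by linarith), min_eq_right (hf0 x)]
  have hmono : ∀ τ, Monotone fun n => layeredSup k φ V (tentTruncation f n) τ := fun τ _ _ h z =>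
    layeredSup_mono hφ (fun x => tentTruncation_mono x h) z
  have hlim : ∀ τ, 0 ≤ τ → ∫⁻ z, layeredSup k φ V f τ z
      = ⨆ n, ∫⁻ z, layeredSup k φ V (tentTruncation f n) τ z := by
    intro τ hτ
    rw [funext (layeredSup_eq_iSup hφ), lintegral_iSup (fun n => ?_) (hmono τ)]
    obtain ⟨M, hM⟩ := (hcs n).exists_bound_of_continuous (hc n)
    exact measurable_layeredSup hk hφ hV (hc n) (hcs n)
      (fun x => (le_abs_self _).trans (hM x)) hτ
  have hmono' : ∀ (a : ℝ≥0∞) (τ : ℝ),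
      Monotone fun n => a * ∫⁻ z, layeredSup k φ V (tentTruncation f n) τ z :=
    fun a τ _ _ h => mul_le_mul_right (lintegral_mono (hmono τ h)) a
  rw [hlim s hs, hlim t (hs.trans hst.le), ENNReal.mul_iSup, ENNReal.mul_iSup,
    ENNReal.iSup_add_iSup_of_monotone (hmono' _ s) (hmono' _ t)]
  exact iSup_le fun n => (lintegral_layeredSup_concave_of_hasCompactSupport hk hφ hV (hc n)
    (hcs n) hs hst hθ0 hθ1).trans
      (lintegral_mono fun z => layeredSup_mono hφ (fun x => min_le_left _ _) z)

end layeredSup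

/-! ### The power and logarithmic profiles -/

/-- A convex decreasing function `F` vanishing at infinity is the superposition of the hinges
`(c - w)₊` with density `F''`. The values of `F''` below `w` are irrelevant, since the hinge vanishes
there. -/
theorem lintegral_hinge_mul {F F' F'' : ℝ → ℝ} {w : ℝ}
    (hF : ∀ c ∈ Ici w, HasDerivAt F (F' c) c) (hF' : ∀ c ∈ Ici w, HasDerivAt F' (F'' c) c)
    (hpos : ∀ c ∈ Ioi w, 0 ≤ F'' c) (hlim : Tendsto F atTop (𝓝 0))
    (hlim' : Tendsto (fun c => (c - w) * F' c) atTop (𝓝 0)) :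
    ∫⁻ c, ENNReal.ofReal (c - w) * ENNReal.ofReal (F'' c) = ENNReal.ofReal (F w) := by
  have hd : ∀ c ∈ Ici w, HasDerivAt (fun c => (c - w) * F' c - F c) ((c - w) * F'' c) c := by
    intro c hc
    convert! (((hasDerivAt_id c).sub_const w).mul (hF' c hc)).sub (hF c hc) using 1
    simp
  have hn : ∀ c ∈ Ioi w, 0 ≤ (c - w) * F'' c := fun c hc =>
    mul_nonneg (sub_nonneg.2 (le_of_lt hc)) (hpos c hc)
  have hl : Tendsto (fun c => (c - w) * F' c - F c) atTop (𝓝 0) := by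
    simpa using hlim'.sub hlim
  have h1 := integral_Ioi_of_hasDerivAt_of_nonneg' hd hn hl
  have h2 := integrableOn_Ioi_deriv_of_nonneg' hd hn hl
  have h3 : ENNReal.ofReal (F w) = ENNReal.ofReal (∫ c in Ioi w, (c - w) * F'' c) := by
    rw [h1]; simp
  rw [h3, ofReal_integral_eq_lintegral_ofReal h2
    ((ae_restrict_iff' measurableSet_Ioi).2 (Eventually.of_forall hn)),
    ← lintegral_indicator measurableSet_Ioi]
  refine lintegral_congr fun c => ?_
  by_cases hc : c ∈ Ioi w
  · rw [indicator_of_mem hc, ENNReal.ofReal_mul (sub_nonneg.2 (le_of_lt hc))]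
  · rw [indicator_of_notMem hc, ENNReal.ofReal_of_nonpos (sub_nonpos.2 (not_lt.1 hc)), zero_mul]

theorem lintegral_hinge_mul_exp (w : ℝ) :
    ∫⁻ c, ENNReal.ofReal (c - w) * ENNReal.ofReal (Real.exp (-c))
      = ENNReal.ofReal (Real.exp (-w)) := by
  have h0 : Tendsto (fun c : ℝ => Real.exp (-c)) atTop (𝓝 0) := Real.tendsto_exp_neg_atTop_nhds_zero
  have h1 : Tendsto (fun c : ℝ => c * Real.exp (-c)) atTop (𝓝 0) := by
    simpa using Real.tendsto_pow_mul_exp_neg_atTop_nhds_zero 1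
  refine lintegral_hinge_mul (F := fun c => Real.exp (-c)) (F' := fun c => -Real.exp (-c))
    (F'' := fun c => Real.exp (-c))
    (fun c _ => ?_) (fun c _ => ?_) (fun c _ => (Real.exp_pos _).le) h0 ?_
  · simpa using (hasDerivAt_neg c).exp
  · convert! (hasDerivAt_neg c).exp.neg using 1
    simp
  · have := (h1.neg).add (h0.const_mul w)
    simp only [neg_zero, mul_zero, add_zero] at this
    exact this.congr fun c => by ring

theorem lintegral_hinge_mul_rpow {κ w : ℝ} (hκ : κ < 0) (hw : 0 < w) :
    ∫⁻ c, ENNReal.ofReal (c - w) * ENNReal.ofReal (κ * (κ - 1) * c ^ (κ - 2))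
      = ENNReal.ofReal (w ^ κ) := by
  have h0 : Tendsto (fun c : ℝ => c ^ κ) atTop (𝓝 0) := by
    simpa using tendsto_rpow_neg_atTop (neg_pos.2 hκ)
  have h1 : Tendsto (fun c : ℝ => c ^ (κ - 1)) atTop (𝓝 0) := by
    simpa using tendsto_rpow_neg_atTop (y := 1 - κ) (by linarith)
  refine lintegral_hinge_mul (F := fun c => c ^ κ) (F' := fun c => κ * c ^ (κ - 1))
    (F'' := fun c => κ * (κ - 1) * c ^ (κ - 2)) (fun c hc => ?_) (fun c hc => ?_)
    (fun c hc => ?_) h0 ?_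
  · exact Real.hasDerivAt_rpow_const (Or.inl (hw.trans_le hc).ne')
  · have := (Real.hasDerivAt_rpow_const (p := κ - 1) (Or.inl (hw.trans_le hc).ne')).const_mul κ
    rwa [← mul_assoc, show κ - 1 - 1 = κ - 2 by ring] at this
  · have : 0 < c := hw.trans hc
    exact mul_nonneg (by nlinarith) (by positivity)
  · have := (h0.const_mul κ).sub (h1.const_mul (w * κ))
    simp only [mul_zero, sub_zero] at this
    refine this.congr' ?_
    filter_upwards [eventually_gt_atTop 0] with c hc
    have e : c ^ κ = c * c ^ (κ - 1) := by
      rw [Real.rpow_sub_one hc.ne']; field_simp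
    rw [e]; ring

theorem isProfile_neg_log : IsProfile fun r => -Real.log r where
  continuousOn := (Real.continuousOn_log.mono fun _ hr => ne_of_gt hr).neg
  antitoneOn := fun _ hr _ _ h => neg_le_neg (Real.log_le_log hr h)
  unbounded := fun c => ⟨Real.exp (-c), Real.exp_pos _, by simp⟩

theorem isProfile_rpow {γ : ℝ} (hγ : γ < 0) : IsProfile fun r => r ^ γ where
  continuousOn := fun r hr =>
    (Real.continuousAt_rpow_const r γ (Or.inl (ne_of_gt hr))).continuousWithinAt
  antitoneOn := Real.antitoneOn_rpow_Ioi_of_exponent_nonpos hγ.le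
  unbounded := fun c => by
    have h : 0 < max c 1 := lt_max_of_lt_right one_pos
    refine ⟨max c 1 ^ γ⁻¹, Real.rpow_pos_of_pos h _, ?_⟩
    rw [Real.rpow_inv_rpow h.le hγ.ne]
    exact le_max_left _ _

theorem isConvexPotential_powerPotential {p : ℝ} (hp : 1 ≤ p) :
    IsConvexPotential (powerPotential p) where
  continuous := (continuous_abs.rpow_const fun _ => Or.inr (by linarith)).div_const p
  convex := by
    have hp0 : 0 < p := by linarith
    refine ⟨convex_univ, fun x _ y _ a b ha hb hab => ?_⟩
    have h1 : |a • x + b • y| ≤ a * |x| + b * |y| := by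
      refine (abs_add_le _ _).trans_eq ?_
      simp [abs_mul, abs_of_nonneg ha, abs_of_nonneg hb]
    have h2 := (convexOn_rpow hp).2 (abs_nonneg x) (abs_nonneg y) ha hb hab
    have h3 := (Real.rpow_le_rpow (abs_nonneg _) h1 hp0.le).trans h2
    simp only [powerPotential, smul_eq_mul] at h3 ⊢
    rw [← mul_div_assoc, ← mul_div_assoc, ← add_div]
    gcongr
  zero := by simp [powerPotential, (by linarith : p ≠ 0)]
  nonneg := fun y => div_nonneg (by positivity) (by linarith)
  coercive := by
    have hp0 : 0 < p := by linarith
    refine ⟨p⁻¹, inv_pos.2 hp0, fun y hy => ?_⟩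
    have := Real.self_le_rpow_of_one_le hy hp
    rw [powerPotential, div_eq_inv_mul]
    gcongr

theorem powerPotential_pos {p y : ℝ} (hp : 0 < p) (hy : y ≠ 0) : 0 < powerPotential p y :=
  div_pos (Real.rpow_pos_of_pos (abs_pos.2 hy) p) hp

theorem hopfLaxSup_zero_eq_layeredSup (V f : ℝ → ℝ) (t : ℝ≥0) (z : ℝ) :
    hopfLaxSup 0 V f t z
      = layeredSup (fun c => ENNReal.ofReal (Real.exp (-c))) (fun r => -Real.log r) V f t z := by
  have key : ∀ x y : ℝ, 0 < f x → Real.exp (-(-Real.log (f x) + t * V y))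
      = f x * Real.exp (-(t * V y)) := fun x y hx => by
    rw [neg_add, neg_neg, Real.exp_add, Real.exp_log hx]
  simp only [hopfLaxSup, layeredSup, if_true, lintegral_hinge_mul_exp]
  apply le_antisymm
  · refine iSup_le fun x => iSup_le fun y => iSup_le fun hz => ?_
    rcases le_or_gt (f x) 0 with hx | hx
    · rw [ENNReal.ofReal_of_nonpos (mul_nonpos_of_nonpos_of_nonneg hx (Real.exp_pos _).le)]
      exact zero_le
    · have e : z - t * y = x := by linarith
      refine le_iSup₂_of_le y (by rwa [e]) ?_
      rw [e, key x y hx]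
  · refine iSup₂_le fun y hy => ?_
    refine le_iSup_of_le (z - t * y) (le_iSup_of_le y (le_iSup_of_le (by ring) ?_))
    rw [key _ y hy]

/-- For `γ < 0` the constraint `V y > 0` in `hopfLaxSup` does not affect the supremum. -/
theorem hopfLaxSup_eq_layeredSup {γ : ℝ} (hγ : γ < 0) {V f : ℝ → ℝ} (hV : Continuous V)
    (hV0 : ∀ y, 0 ≤ V y) (hVpos : ∀ y, y ≠ 0 → 0 < V y) (hf : Continuous f) (t : ℝ≥0) (z : ℝ) :
    hopfLaxSup γ V f t z
      = layeredSup (fun c => ENNReal.ofReal (1 / γ * (1 / γ - 1) * c ^ (1 / γ - 2)))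
          (fun r => r ^ γ) V f t z := by
  have hκ : 1 / γ < 0 := one_div_neg.2 hγ
  have hpos : ∀ x y : ℝ, 0 < f x → 0 < f x ^ γ + t * V y := fun x y hx =>
    add_pos_of_pos_of_nonneg (Real.rpow_pos_of_pos hx γ) (mul_nonneg t.2 (hV0 y))
  rw [hopfLaxSup, if_neg hγ.ne, layeredSup]
  apply le_antisymm
  · refine iSup_le fun x => iSup_le fun y => iSup_le fun hz => iSup_le fun hx => iSup_le fun _ => ?_
    have e : z - t * y = x := by linarith
    refine le_iSup₂_of_le y (by rwa [e]) ?_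
    rw [e, lintegral_hinge_mul_rpow hκ (hpos x y hx)]
  · refine iSup₂_le fun y hy => ?_
    rw [lintegral_hinge_mul_rpow hκ (hpos _ y hy)]
    have hle : ∀ η, η ≠ 0 → 0 < f (z - t * η) →
        ENNReal.ofReal ((f (z - t * η) ^ γ + t * V η) ^ (1 / γ))
        ≤ ⨆ (x : ℝ) (y : ℝ) (_ : z = x + t * y) (_ : 0 < f x) (_ : 0 < V y),
          ENNReal.ofReal ((f x ^ γ + t * V y) ^ (1 / γ)) := fun η hη hfη =>
      le_iSup_of_le (z - t * η) (le_iSup_of_le η (le_iSup_of_le (by ring)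
        (le_iSup_of_le hfη (le_iSup_of_le (hVpos η hη) le_rfl))))
    -- The constraint `V y > 0` only excludes `y = 0`, which is a limit of admissible points.
    have hc : ContinuousAt (fun η => (f (z - t * η) ^ γ + t * V η) ^ (1 / γ)) y := by
      have h1 : ContinuousAt (fun η => f (z - t * η)) y := by fun_prop
      exact ((h1.rpow_const (Or.inl hy.ne')).add (by fun_prop)).rpow_const
        (Or.inl (hpos _ y hy).ne')
    have hne : (𝓝[{0}ᶜ] y).NeBot :=
      mem_closure_iff_nhdsWithin_neBot.1 (dense_compl_singleton (0 : ℝ) y)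
    have hev : ∀ᶠ η in 𝓝 y, 0 < f (z - t * η) :=
      (show ContinuousAt (fun η => f (z - t * η)) y by fun_prop).eventually_const_lt hy
    refine le_of_tendsto (((ENNReal.continuous_ofReal.tendsto _).comp hc.tendsto).mono_left
      (nhdsWithin_le_nhds (s := {0}ᶜ))) ?_
    filter_upwards [self_mem_nhdsWithin, hev.filter_mono nhdsWithin_le_nhds] with η hη hfη
    exact hle η hη hfη

/-- Reduction of concavity over `ℝ≥0` to ordered pairs of times and positive weight of the later
one. -/
theorem concaveOn_of_forall_lt {J : ℝ → ℝ≥0∞}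
    (hJ : ∀ s t θ : ℝ, 0 ≤ s → s < t → 0 < θ → θ ≤ 1 →
      ENNReal.ofReal (1 - θ) * J s + ENNReal.ofReal θ * J t ≤ J ((1 - θ) * s + θ * t)) :
    ConcaveOn ℝ≥0 univ fun t : ℝ≥0 => J t := by
  have key : ∀ (s t a b : ℝ≥0), s < t → a + b = 1 →
      (a : ℝ≥0∞) * J s + (b : ℝ≥0∞) * J t ≤ J ((a * s + b * t : ℝ≥0) : ℝ) := by
    intro s t a b hst hab
    rcases eq_or_ne b 0 with rfl | hb
    · have ha : a = 1 := by simpa using hab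
      simp [ha]
    have hab' : (a : ℝ) + b = 1 := by exact_mod_cast hab
    have h := hJ s t b s.2 hst (by positivity) (by linarith [a.2])
    rw [show (1 : ℝ) - b = a by linarith] at h
    simpa using h
  refine ⟨convex_univ, fun s _ t _ a b _ _ hab => ?_⟩
  simp only [ENNReal.smul_def, smul_eq_mul]
  rcases lt_trichotomy s t with h | rfl | h
  · exact key s t a b h hab
  · rw [← add_mul, ← add_mul, hab, one_mul, ← ENNReal.coe_add, hab, ENNReal.coe_one, one_mul]
  · rw [add_comm, add_comm (a * s)]
    exact key t s b a h (by rwa [add_comm])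

theorem theoremB (γ : ℝ) (hγ : γ ∈ Set.Ioc (-1 : ℝ) 0) (p : ℝ) (hp : 1 ≤ p)
    (f : ℝ → ℝ) (hf0 : ∀ x, 0 ≤ f x) (hf : ∃ K : ℝ≥0, LipschitzWith K f) :
    ConcaveOn ℝ≥0 (Set.univ : Set ℝ≥0)
      (fun t : ℝ≥0 => ∫⁻ z : ℝ, hopfLaxSup γ (powerPotential p) f t z) := by
  obtain ⟨K, hK⟩ := hf
  have hV := isConvexPotential_powerPotential hp
  rcases hγ.2.eq_or_lt with rfl | hneg
  · rw [show (fun t : ℝ≥0 => ∫⁻ z : ℝ, hopfLaxSup 0 (powerPotential p) f t z) = _ from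
      funext fun t => lintegral_congr (hopfLaxSup_zero_eq_layeredSup (powerPotential p) f t)]
    exact concaveOn_of_forall_lt
      (J := fun τ => ∫⁻ z, layeredSup (fun c => ENNReal.ofReal (Real.exp (-c)))
        (fun r => -Real.log r) (powerPotential p) f τ z) fun s t θ hs hst h0 h1 =>
      lintegral_layeredSup_concave (by fun_prop) isProfile_neg_log hV hK.continuous hf0 hs hst h0 h1
  · rw [show (fun t : ℝ≥0 => ∫⁻ z : ℝ, hopfLaxSup γ (powerPotential p) f t z) = _ from
      funext fun t => lintegral_congr (hopfLaxSup_eq_layeredSup hneg hV.continuous hV.nonneg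
        (fun y hy => powerPotential_pos (by linarith) hy) hK.continuous t)]
    exact concaveOn_of_forall_lt
      (J := fun τ => ∫⁻ z, layeredSup
        (fun c => ENNReal.ofReal (1 / γ * (1 / γ - 1) * c ^ (1 / γ - 2)))
        (fun r => r ^ γ) (powerPotential p) f τ z) fun s t θ hs hst h0 h1 =>
      lintegral_layeredSup_concave (by fun_prop) (isProfile_rpow hneg) hV hK.continuous hf0
        hs hst h0 h1
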